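/- **Theorem.** There is a polynomial $p$ with coefficients in $\mathbb N$ such that the following holds for every finite simple $3$-regular graph $G=(V,E)$ and every vertex $u\in V$. (In particular, for every family $(G_n)_{n\in\mathbb N}$ of such graphs and every choice of $u_n\in V(G_n)$, the bound below is polynomial in the size of the instance.) Let $E(v)$ be the set of edges incident to $v$, let $X=\{x^e_i : e\in E,\ i\in\mathbb F_2\}$, and let $\mathrm{CFI}(G,u,1)$ be the following system of polynomial equations over $\mathbb F_2$: * $x^e_i+x^f_j+x^g_k=i+j+k$ for every $v\in V\setminus\{u\}$ with $E(v)=\{e,f,g\}$ and all $i,j,k\in\mathbb F_2$; * $x^e_i+x^f_j+x^g_k=i+j+k+1$ for $E(u)=\{e,f,g\}$ and all $i,j,k\in\mathbb F_2$; * $x^e_0+x^e_1=1$ for every $e\in E$; * $(x^e_i)^2-x^e_i=0$ for every $e\in E$ and $i\in\mathbb F_2$. Let $\Gamma\le\mathbb F_2^E$ be the group of all $\pi$ with $\sum_{e\in E(v)}\pi_e=0$ for every $v\in V$. It acts on $X$ by $\pi(x^e_i)=x^e_{i+\pi_e}$, and this action permutes the polynomials $f_1,\dots,f_m$ of the system (right-hand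 sides moved to the left). Let $Y=\{y_1,\dots,y_m\}$ be new variables, with $\pi(y_i)=y_j$ whenever $\pi(f_i)=f_j$. Then there is an algebraic circuit $C$ over $\mathbb F_2$ with variables in $X\uplus Y$ such that 1. $C$ is an IPS refutation of $\mathrm{CFI}(G,u,1)$: the polynomial $C(\vec x,\vec y)$ computed by $C$ satisfies $C(\vec x,\vec 0)=0$ and $C(\vec x,\vec f)=1$; 2. $C$ is $\Gamma$-symmetric: every $\pi\in\Gamma$ extends to an automorphism of $C$, i.e. there is a permutation of the gates that preserves the wires and the labels of internal gates, fixes the constant labels of input gates, and acts as $\pi$ on the variable labels of input gates; 3. $C$ is not $\vec y$-linear: $C(\vec x,\vec y)$ is not of the form $\sum_{i=1}^m y_i\,g_i(\vec x)$ with $g_i\in\mathbb F_2[X]$; 4. $\max(|C|,\,|X|+|Y|)\le p(|X|+m)$, where $|C|$ is the number of gates of $C$. Here an algebraic circuit is a finite connected directed acyclic graph with exactly one output gate, whose gates of in-degree $0$ are labelled by variables or constants and whose other gates are labelled by $+$ or $\times$. -/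

import Mathlib

/-! ### Algebraic circuits -/

/-- Labels of gates of an algebraic circuit over the variables `X` and the field `K`. -/
inductive GateLabel (X K : Type) where
  | add : GateLabel X K
  | mul : GateLabel X K
  | var : X → GateLabel X K
  | const : K → GateLabel X K

/-- The label is a variable or a constant. -/
def GateLabel.IsInput {X K : Type} : GateLabel X K → Prop
  | .add => False
  | .mul => False
  | .var _ => True
  | .const _ => True

/-- Apply a map to the variables; the labels `+`, `×` and the constants are fixed. -/
def GateLabel.map {X X' K : Type} (φ : X → X') : GateLabel X K → GateLabel X' K
  | .add => .add
  | .mul => .mul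
  | .var x => .var (φ x)
  | .const c => .const c

/-- An algebraic circuit over the variables `X` and the field `K`: a finite directed acyclic graph
with labelled gates and exactly one output gate. There is a wire from `h` to `g` iff
`h ∈ children g`. The gates without incoming wires, and only those, are labelled by
variables or constants; several gates may carry the same label. The fan-in is unbounded.
(A finite acyclic graph with exactly one sink is automatically nonempty and connected.) -/
structure AlgCircuit (X K : Type) where
  Gate : Type
  [fintypeGate : Fintype Gate]
  children : Gate → Finset Gate
  acyclic : ∀ g, ¬ Relation.TransGen (fun h h' => h ∈ children h') g g
  label : Gate → GateLabel X K
  label_isInput_iff : ∀ g, (label g).IsInput ↔ children g = ∅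
  output : Gate
  eq_output_iff : ∀ g, g = output ↔ ∀ h, g ∉ children h

attribute [instance] AlgCircuit.fintypeGate

namespace AlgCircuit

variable {X K : Type}

theorem wellFounded (C : AlgCircuit X K) :
    WellFounded (fun h h' : C.Gate => h ∈ C.children h') := by
  have hirr : Std.Irrefl (Relation.TransGen (fun h h' : C.Gate => h ∈ C.children h')) :=
    ⟨C.acyclic⟩
  exact (Finite.wellFounded_of_trans_of_irrefl
    (Relation.TransGen (fun h h' : C.Gate => h ∈ C.children h'))).mono
      (fun _ _ h => Relation.TransGen.single h)

/-- The polynomial computed at a gate. -/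
noncomputable def gatePoly [Field K] (C : AlgCircuit X K) : C.Gate → MvPolynomial X K :=
  C.wellFounded.fix fun g rec =>
    match C.label g with
    | .add => ∑ h : {h // h ∈ C.children g}, rec h.1 h.2
    | .mul => ∏ h : {h // h ∈ C.children g}, rec h.1 h.2
    | .var x => MvPolynomial.X x
    | .const c => MvPolynomial.C c

theorem gatePoly_eq [Field K] (C : AlgCircuit X K) (g : C.Gate) :
    C.gatePoly g =
      match C.label g with
      | .add => ∑ h ∈ C.children g, C.gatePoly h
      | .mul => ∏ h ∈ C.children g, C.gatePoly h
      | .var x => MvPolynomial.X x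
      | .const c => MvPolynomial.C c := by
  conv_lhs => rw [gatePoly, WellFounded.fix_eq]
  cases C.label g with
  | add => exact Finset.sum_coe_sort (C.children g) (fun h => C.gatePoly h)
  | mul => exact Finset.prod_coe_sort (C.children g) (fun h => C.gatePoly h)
  | var x => rfl
  | const c => rfl

/-- The polynomial computed by the circuit. -/
noncomputable def poly [Field K] (C : AlgCircuit X K) : MvPolynomial X K :=
  C.gatePoly C.output

/-- `C` is `Γ`-symmetric: every `γ : Γ` extends to an automorphism of the circuit, that is, to a
permutation of the gates which preserves the wires and the labels of the internal gates, fixes the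
constants at input gates and acts as `γ` on the variables at input gates. -/
def IsSymmetric (Γ : Type) [Group Γ] [MulAction Γ X] (C : AlgCircuit X K) : Prop :=
  ∀ γ : Γ, ∃ σ : Equiv.Perm C.Gate,
    (∀ g h, σ h ∈ C.children (σ g) ↔ h ∈ C.children g) ∧
    ∀ g, C.label (σ g) = (C.label g).map (fun x => γ • x)

end AlgCircuit

/-! ### The ideal proof system -/

section IPS

variable {X ι K : Type} [Field K]

/-- The polynomial `P(x, y)`, with one variable `y i` for every equation `f i = 0`, is an IPS
certificate for the system `f`: `P(x, 0) = 0` and `P(x, f) = 1`. -/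
def IsIPSCertificate (f : ι → MvPolynomial X K) (P : MvPolynomial (X ⊕ ι) K) : Prop :=
  MvPolynomial.aeval (Sum.elim MvPolynomial.X (fun _ => 0) : X ⊕ ι → MvPolynomial X K) P = 0 ∧
  MvPolynomial.aeval (Sum.elim MvPolynomial.X f : X ⊕ ι → MvPolynomial X K) P = 1

/-- `P(x, y)` is `y`-linear: it has the form `∑ i, y i * g i (x)`. -/
def IsYLinear [Fintype ι] (P : MvPolynomial (X ⊕ ι) K) : Prop :=
  ∃ g : ι → MvPolynomial X K,
    P = ∑ i, MvPolynomial.X (Sum.inr i) * MvPolynomial.rename Sum.inl (g i)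

/-- `f` lists a `Γ`-invariant set of polynomials without repetitions, and the action of `Γ` on the
index set is the one induced by the action on the polynomials. -/
structure IsInvariantSystem (Γ : Type) [Group Γ] [MulAction Γ X] [MulAction Γ ι]
    (f : ι → MvPolynomial X K) : Prop where
  injective : Function.Injective f
  rename_eq : ∀ (γ : Γ) (i : ι), MvPolynomial.rename (fun x => γ • x) (f i) = f (γ • i)

/-- `C` is a `Γ`-symmetric IPS refutation of the `Γ`-invariant system `f`. The group acts on the
variables `X ⊕ ι` of `C` componentwise. -/
structure IsSymIPSRefutation (Γ : Type) [Group Γ] [MulAction Γ X] [MulAction Γ ι]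
    (f : ι → MvPolynomial X K) (C : AlgCircuit (X ⊕ ι) K) : Prop where
  invariant : IsInvariantSystem Γ f
  certificate : IsIPSCertificate f C.poly
  symmetric : C.IsSymmetric Γ

/-- The size of a system of equations: the number of variables plus the number of equations. -/
def systemSize [Fintype X] [Fintype ι] (_f : ι → MvPolynomial X K) : ℕ :=
  Fintype.card X + Fintype.card ι

/-- The size of an IPS refutation: the number of gates, but at least the number of variables. -/
def ipsSize [Fintype X] [Fintype ι] (C : AlgCircuit (X ⊕ ι) K) : ℕ :=
  max (Fintype.card C.Gate) (Fintype.card X + Fintype.card ι)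

end IPS

/-! ### The Cai-Fürer-Immerman equations -/

section CFI

variable {V : Type} (G : SimpleGraph V)

/-- The set `E(v)` of edges incident to `v`. -/
abbrev IncEdge (v : V) : Type := {e : G.edgeSet // v ∈ (e : Sym2 V)}

/-- The variable `x^e_i` for an edge `e` and `i ∈ 𝔽₂`. -/
structure CFIVar where
  edge : G.edgeSet
  val : ZMod 2

/-- The index set of the equations. A map `s : E(v) → 𝔽₂` is the same thing as a choice of
`i, j, k ∈ 𝔽₂` for the edges `e, f, g` of `E(v)`. -/
inductive CFIEq where
  | vertex (v : V) (s : IncEdge G v → ZMod 2) : CFIEq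
  | edge (e : G.edgeSet) : CFIEq
  | bool (e : G.edgeSet) (i : ZMod 2) : CFIEq

def CFIVar.equivProd : CFIVar G ≃ G.edgeSet × ZMod 2 where
  toFun x := (x.edge, x.val)
  invFun x := ⟨x.1, x.2⟩
  left_inv _ := rfl
  right_inv _ := rfl

def CFIEq.equivSum :
    CFIEq G ≃ (Σ v : V, IncEdge G v → ZMod 2) ⊕ G.edgeSet ⊕ (G.edgeSet × ZMod 2) where
  toFun
    | .vertex v s => .inl ⟨v, s⟩
    | .edge e => .inr (.inl e)
    | .bool e i => .inr (.inr (e, i))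
  invFun
    | .inl ⟨v, s⟩ => .vertex v s
    | .inr (.inl e) => .edge e
    | .inr (.inr (e, i)) => .bool e i
  left_inv := by rintro (_ | _ | _) <;> rfl
  right_inv := by rintro (_ | _ | _) <;> rfl

variable [Fintype V] [DecidableEq V] [DecidableRel G.Adj]

instance CFIVar.instFintype : Fintype (CFIVar G) := Fintype.ofEquiv _ (CFIVar.equivProd G).symm

instance CFIEq.instFintype : Fintype (CFIEq G) := Fintype.ofEquiv _ (CFIEq.equivSum G).symm

/-- The polynomials `p` of the equations `p = 0` of `CFI(G, u, a)`, including the Boolean axioms. -/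
noncomputable def cfiSystem (u : V) (a : ZMod 2) : CFIEq G → MvPolynomial (CFIVar G) (ZMod 2)
  | .vertex v s =>
      (∑ e : IncEdge G v, MvPolynomial.X ⟨e.1, s e⟩) -
        MvPolynomial.C ((∑ e : IncEdge G v, s e) + if v = u then a else 0)
  | .edge e => MvPolynomial.X ⟨e, 0⟩ + MvPolynomial.X ⟨e, 1⟩ - 1
  | .bool e i => MvPolynomial.X ⟨e, i⟩ ^ 2 - MvPolynomial.X ⟨e, i⟩

/-- The group `Γ` of edge flips: the subgroup of `𝔽₂^E` of all `π` with `∑_{e ∈ E(v)} π e = 0` for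
every vertex `v`. -/
def edgeFlipGroup : AddSubgroup (G.edgeSet → ZMod 2) where
  carrier := {π | ∀ v : V, ∑ e : IncEdge G v, π e.1 = 0}
  zero_mem' := by intro v; simp
  add_mem' := by
    intro π ρ hπ hρ v
    simp only [Set.mem_ofPred_eq] at hπ hρ
    simp [Finset.sum_add_distrib, hπ v, hρ v]
  neg_mem' := by
    intro π hπ v
    simp only [Set.mem_ofPred_eq] at hπ
    simp [hπ v]

/-- `π(x^e_i) = x^e_{i + π e}`. -/
instance CFIVar.instAddAction : AddAction (edgeFlipGroup G) (CFIVar G) where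
  vadd π x := ⟨x.edge, x.val + (π : G.edgeSet → ZMod 2) x.edge⟩
  zero_vadd x := congrArg (CFIVar.mk x.edge) (add_zero x.val)
  add_vadd π ρ x := congrArg (CFIVar.mk x.edge) (by
    change x.val + ((π : G.edgeSet → ZMod 2) x.edge + (ρ : G.edgeSet → ZMod 2) x.edge) =
      x.val + (ρ : G.edgeSet → ZMod 2) x.edge + (π : G.edgeSet → ZMod 2) x.edge
    ring)

/-- The action of the edge flips on the equations. -/
instance CFIEq.instAddAction : AddAction (edgeFlipGroup G) (CFIEq G) where
  vadd π y := match y with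
    | .vertex v s => .vertex v (fun e => s e + (π : G.edgeSet → ZMod 2) e.1)
    | .edge e => .edge e
    | .bool e i => .bool e (i + (π : G.edgeSet → ZMod 2) e)
  zero_vadd y := match y with
    | .vertex v s => congrArg (CFIEq.vertex v) (funext fun e => add_zero (s e))
    | .edge _ => rfl
    | .bool e i => congrArg (CFIEq.bool e) (add_zero i)
  add_vadd π ρ y := match y with
    | .vertex v s => congrArg (CFIEq.vertex v) (funext fun e => by
        change s e + ((π : G.edgeSet → ZMod 2) e.1 + (ρ : G.edgeSet → ZMod 2) e.1) =
          s e + (ρ : G.edgeSet → ZMod 2) e.1 + (π : G.edgeSet → ZMod 2) e.1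
        ring)
    | .edge _ => rfl
    | .bool e i => congrArg (CFIEq.bool e) (by
        change i + ((π : G.edgeSet → ZMod 2) e + (ρ : G.edgeSet → ZMod 2) e) =
          i + (ρ : G.edgeSet → ZMod 2) e + (π : G.edgeSet → ZMod 2) e
        ring)

end CFI

set_option linter.unusedSectionVars false

namespace CFI

/-! For `s : E(v) → 𝔽₂` let `M(v,s)` be the product over all edges `e` of `x^e_{s e}` if `v ∈ e` and
of `x^e_0 + x^e_1` otherwise. The refutation is `1 + ∏_e (1 + y_e) + ∑_{v,s} (y_{v,s} M(v,s) + ∑_{e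
∈ E(v)} y_{e, s e} M(v,s) / x^e_{s e})`. At `y = 0` it is `1 + 1 = 0`. At `y = f` the Boolean axioms
replace each `x^e_{s e} M(v,s)` by `M(v,s)`, so the bracket becomes `c(v,s) M(v,s)`, where `c(v,s) =
1 + ∑ s + [v = u]` (`cfiSystem_term`).

Expanding, `M(v,s)` is the sum of `∏_e x^e_{t e}` over all `t : E → 𝔽₂` extending `s`
(`prod_factor`). The coefficient of the monomial of `t` in the whole sum is then `∑_v c(v, t|E(v))`,
which is 1: every edge is counted twice, `|V|` is even, and `u` contributes 1
(`sum_one_add_parity`). So the sum is `∏_e (x^e_0 + x^e_1)`, which cancels `∏_e (1 + f_e)` and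
leaves 1.

A flip fixes every vertex and edge and only permutes the assignments `s`, so it permutes the terms.
There are 8 assignments per vertex, which keeps the circuit linear in the size of the system. The
product `∏_e (1 + y_e)` is what destroys `y`-linearity. -/

theorem eq_zero_or_eq_one (i : ZMod 2) : i = 0 ∨ i = 1 := by
  revert i
  decide

/-! ### The circuit: gates, wires and labels. -/

variable {V : Type} (G : SimpleGraph V)

/-- The index of a product term of the refutation: a vertex `v`, an assignment of the edges at `v`,
and either an edge at `v` (whose Boolean axiom is used) or none (the vertex equation is used). -/
abbrev TermIndex : Type := Σ v : V, (IncEdge G v → ZMod 2) × Option (IncEdge G v)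

/-- The gates of the symmetric refutation of the CFI equations. -/
inductive Gate where
  | one : Gate
  | var (z : CFIVar G ⊕ CFIEq G) : Gate
  | edgeFactor (e : G.edgeSet) : Gate
  | edgeProd : Gate
  | pair (e : G.edgeSet) : Gate
  | term (t : TermIndex G) : Gate
  | out : Gate

def Gate.equivSum :
    Gate G ≃ Fin 3 ⊕ (CFIVar G ⊕ CFIEq G) ⊕ G.edgeSet ⊕ G.edgeSet ⊕ TermIndex G where
  toFun
    | .one => .inl 0
    | .edgeProd => .inl 1
    | .out => .inl 2
    | .var z => .inr (.inl z)
    | .edgeFactor e => .inr (.inr (.inl e))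
    | .pair e => .inr (.inr (.inr (.inl e)))
    | .term t => .inr (.inr (.inr (.inr t)))
  invFun
    | .inl 0 => .one
    | .inl 1 => .edgeProd
    | .inl 2 => .out
    | .inr (.inl z) => .var z
    | .inr (.inr (.inl e)) => .edgeFactor e
    | .inr (.inr (.inr (.inl e))) => .pair e
    | .inr (.inr (.inr (.inr t))) => .term t
  left_inv := by rintro (_ | _ | _ | _ | _ | _ | _) <;> rfl
  right_inv := by
    rintro (i | _ | _ | _ | _)
    · fin_cases i <;> rfl
    all_goals rfl

variable [Fintype V] [DecidableEq V] [DecidableRel G.Adj]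

instance : Fintype (Gate G) := Fintype.ofEquiv _ (Gate.equivSum G).symm

variable {G}

open Classical in
/-- The gate for the factor which the edge `e` contributes to a term at the vertex `v`. -/
noncomputable def factorGate (v : V) (s : IncEdge G v → ZMod 2) (e : G.edgeSet) : Gate G :=
  if h : v ∈ (e : Sym2 V) then .var (.inl ⟨e, s ⟨e, h⟩⟩) else .pair e

/-- Children form a set, so distinct edges need distinct gates for no factor of a term to be lost.
-/
theorem factorGate_injective (v : V) (s : IncEdge G v → ZMod 2) :
    Function.Injective (factorGate v s) := by
  intro e e' h
  unfold factorGate at h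
  split_ifs at h <;> simp_all

open Classical in
/-- The wires of the refutation. -/
noncomputable def gateChildren : Gate G → Finset (Gate G)
  | .one => ∅
  | .var _ => ∅
  | .edgeFactor e => {.one, .var (.inr (.edge e))}
  -- The neutral factor `.one` keeps this product gate from having no inputs when there are no
  -- edges.
  | .edgeProd => insert .one (Finset.univ.image .edgeFactor)
  | .pair e => {.var (.inl ⟨e, 0⟩), .var (.inl ⟨e, 1⟩)}
  | .term ⟨v, s, none⟩ => insert (.var (.inr (.vertex v s))) (Finset.univ.image (factorGate v s))
  | .term ⟨v, s, some e⟩ =>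
      insert (.var (.inr (.bool e.1 (s e)))) ((Finset.univ.erase e.1).image (factorGate v s))
  | .out => insert .one (insert .edgeProd (Finset.univ.image .term))

/-- The labels of the gates of the refutation. -/
def gateLabel : Gate G → GateLabel (CFIVar G ⊕ CFIEq G) (ZMod 2)
  | .one => .const 1
  | .var z => .var z
  | .edgeFactor _ => .add
  | .edgeProd => .mul
  | .pair _ => .add
  | .term _ => .mul
  | .out => .add

/-- The height of a gate in the refutation. -/
def gateHeight : Gate G → ℕ
  | .one => 0
  | .var _ => 0
  | .edgeFactor _ => 1
  | .pair _ => 1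
  | .edgeProd => 2
  | .term _ => 2
  | .out => 3

theorem gateHeight_factorGate_lt (v : V) (s : IncEdge G v → ZMod 2) (e : G.edgeSet) :
    gateHeight (factorGate v s e) < 2 := by
  unfold factorGate
  split_ifs <;> simp [gateHeight]

theorem gateHeight_lt {g h : Gate G} (hg : h ∈ gateChildren g) : gateHeight h < gateHeight g := by
  rcases g with _ | _ | _ | _ | _ | ⟨v, s, _ | e⟩ | _ <;>
    simp only [gateChildren, Finset.mem_insert, Finset.mem_image, Finset.mem_singleton,
      Finset.notMem_empty] at hg
  · rcases hg with rfl | rfl <;> simp [gateHeight]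
  · rcases hg with rfl | ⟨e, -, rfl⟩ <;> simp [gateHeight]
  · rcases hg with rfl | rfl <;> simp [gateHeight]
  · rcases hg with rfl | ⟨e, -, rfl⟩
    · simp [gateHeight]
    · exact gateHeight_factorGate_lt v s e
  · rcases hg with rfl | ⟨e, -, rfl⟩
    · simp [gateHeight]
    · exact gateHeight_factorGate_lt v s e
  · rcases hg with rfl | rfl | ⟨e, -, rfl⟩ <;> simp [gateHeight]

theorem gateLabel_isInput_iff (g : Gate G) : (gateLabel g).IsInput ↔ gateChildren g = ∅ := by
  rcases g with _ | _ | _ | _ | _ | ⟨v, s, _ | e⟩ | _ <;>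
    simp [gateLabel, gateChildren, GateLabel.IsInput]

/-- The gate `.pair e` feeds only the terms at vertices off `e`; `hG` supplies such a vertex, so
`.pair e` is not a second output. -/
theorem eq_out_iff (hG : ∀ e : G.edgeSet, ∃ v, v ∉ (e : Sym2 V)) (g : Gate G) :
    g = .out ↔ ∀ h, g ∉ gateChildren h := by
  constructor
  · rintro rfl h hh
    have := gateHeight_lt hh
    rcases h with _ | _ | _ | _ | _ | _ | _ <;> simp [gateHeight] at this
  · intro h
    rcases g with _ | (⟨e, i⟩ | ⟨v, s⟩ | e | ⟨e, i⟩) | e | _ | e | t | _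
    · exact absurd (by simp [gateChildren]) (h .out)
    · refine absurd ?_ (h (.pair e))
      obtain rfl | rfl := eq_zero_or_eq_one i
      all_goals simp [gateChildren]
    · exact absurd (by simp [gateChildren]) (h (.term ⟨v, s, none⟩))
    · exact absurd (by simp [gateChildren]) (h (.edgeFactor e))
    -- A Boolean axiom is read by a term at an endpoint of `e` whose assignment takes the value `i`
    -- on `e`; a constant assignment will do.
    · obtain ⟨v, hv⟩ : ∃ v, v ∈ (e : Sym2 V) := ⟨_, Sym2.out_fst_mem _⟩
      exact absurd (by simp [gateChildren]) (h (.term ⟨v, fun _ => i, some ⟨e, hv⟩⟩))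
    · exact absurd (by simp [gateChildren]) (h .edgeProd)
    · exact absurd (by simp [gateChildren]) (h .out)
    · obtain ⟨v, hv⟩ := hG e
      refine absurd ?_ (h (.term ⟨v, 0, none⟩))
      simp only [gateChildren, Finset.mem_insert, Finset.mem_image]
      exact Or.inr ⟨e, Finset.mem_univ _, by simp [factorGate, hv]⟩
    · exact absurd (by simp [gateChildren]) (h .out)
    · rfl

variable (G) in
/-- The symmetric refutation of the CFI equations, as a circuit. -/
noncomputable def circuit (hG : ∀ e : G.edgeSet, ∃ v, v ∉ (e : Sym2 V)) :
    AlgCircuit (CFIVar G ⊕ CFIEq G) (ZMod 2) where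
  Gate := Gate G
  children := gateChildren
  acyclic g hg := by
    have key : ∀ a b : Gate G, Relation.TransGen (fun h h' => h ∈ gateChildren h') a b →
        gateHeight a < gateHeight b := by
      intro a b hab
      induction hab with
      | single h => exact gateHeight_lt h
      | tail _ h ih => exact ih.trans (gateHeight_lt h)
    exact (key g g hg).false
  label := gateLabel
  label_isInput_iff := gateLabel_isInput_iff
  output := .out
  eq_output_iff := eq_out_iff hG

/-! ### The computed polynomial -/

open MvPolynomial

open Classical in
/-- The factor which the edge `e` contributes to a term at the vertex `v`. -/
noncomputable def factor (v : V) (s : IncEdge G v → ZMod 2) (e : G.edgeSet) :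
    MvPolynomial (CFIVar G) (ZMod 2) :=
  if h : v ∈ (e : Sym2 V) then X ⟨e, s ⟨e, h⟩⟩ else X ⟨e, 0⟩ + X ⟨e, 1⟩

section gatePoly

variable (hG : ∀ e : G.edgeSet, ∃ v, v ∉ (e : Sym2 V))

/-- The polynomial computed at a gate of the refutation. -/
noncomputable def gateValue (g : Gate G) : MvPolynomial (CFIVar G ⊕ CFIEq G) (ZMod 2) :=
  (circuit G hG).gatePoly g

theorem gateValue_eq (g : Gate G) :
    gateValue hG g =
      match gateLabel g with
      | .add => ∑ h ∈ gateChildren g, gateValue hG h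
      | .mul => ∏ h ∈ gateChildren g, gateValue hG h
      | .var x => X x
      | .const c => C c := by
  rcases g with _ | _ | _ | _ | _ | _ | _ <;> exact (circuit G hG).gatePoly_eq _

theorem gateValue_one : gateValue hG (Gate.one : Gate G) = 1 :=
  (gateValue_eq hG _).trans C_1

theorem gateValue_var (z : CFIVar G ⊕ CFIEq G) : gateValue hG (Gate.var z) = X z :=
  gateValue_eq hG _

theorem gateValue_edgeFactor (e : G.edgeSet) :
    gateValue hG (Gate.edgeFactor e) = 1 + X (.inr (.edge e)) := by
  classical
  refine (gateValue_eq hG _).trans ?_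
  change ∑ h ∈ gateChildren (.edgeFactor e), gateValue hG h = _
  rw [gateChildren, Finset.sum_pair (by simp), gateValue_one, gateValue_var]

theorem gateValue_pair (e : G.edgeSet) :
    gateValue hG (Gate.pair e) = X (.inl ⟨e, 0⟩) + X (.inl ⟨e, 1⟩) := by
  classical
  refine (gateValue_eq hG _).trans ?_
  change ∑ h ∈ gateChildren (.pair e), gateValue hG h = _
  rw [gateChildren, Finset.sum_pair (by simp), gateValue_var, gateValue_var]

theorem gateValue_factorGate (v : V) (s : IncEdge G v → ZMod 2) (e : G.edgeSet) :
    gateValue hG (factorGate v s e) = rename .inl (factor v s e) := by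
  unfold factorGate factor
  split_ifs with h
  · rw [gateValue_var, rename_X]
  · rw [gateValue_pair, map_add, rename_X, rename_X]

theorem gateValue_edgeProd :
    gateValue hG (Gate.edgeProd : Gate G) =
      ∏ e : G.edgeSet, (1 + X (.inr (.edge e))) := by
  classical
  refine (gateValue_eq hG _).trans ?_
  change ∏ h ∈ gateChildren .edgeProd, gateValue hG h = _
  rw [gateChildren, Finset.prod_insert (by simp), Finset.prod_image (by intro a; simp),
    gateValue_one, one_mul]
  exact Finset.prod_congr rfl fun e _ => gateValue_edgeFactor hG e

theorem gateValue_term_none (v : V) (s : IncEdge G v → ZMod 2) :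
    gateValue hG (Gate.term ⟨v, s, none⟩) =
      X (.inr (.vertex v s)) * rename .inl (∏ e, factor v s e) := by
  classical
  refine (gateValue_eq hG _).trans ?_
  change ∏ h ∈ gateChildren (.term ⟨v, s, none⟩), gateValue hG h = _
  rw [gateChildren, Finset.prod_insert, Finset.prod_image (factorGate_injective v s).injOn,
    gateValue_var, map_prod]
  · exact congrArg _ (Finset.prod_congr rfl fun e _ => gateValue_factorGate hG v s e)
  · simp only [Finset.mem_image, not_exists, not_and]
    intro e _ h
    unfold factorGate at h
    split_ifs at h
    simp at h

theorem gateValue_term_some (v : V) (s : IncEdge G v → ZMod 2) (e : IncEdge G v) :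
    gateValue hG (Gate.term ⟨v, s, some e⟩) =
      X (.inr (.bool e.1 (s e))) * rename .inl (∏ e' ∈ Finset.univ.erase e.1, factor v s e') := by
  classical
  refine (gateValue_eq hG _).trans ?_
  change ∏ h ∈ gateChildren (.term ⟨v, s, some e⟩), gateValue hG h = _
  rw [gateChildren, Finset.prod_insert, Finset.prod_image (factorGate_injective v s).injOn,
    gateValue_var, map_prod]
  · exact congrArg _ (Finset.prod_congr rfl fun e _ => gateValue_factorGate hG v s e)
  · simp only [Finset.mem_image, not_exists, not_and]
    intro e _ h
    unfold factorGate at h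
    split_ifs at h
    simp at h

theorem poly_circuit :
    (circuit G hG).poly = 1 + (∏ e : G.edgeSet, (1 + X (.inr (.edge e))) +
      ∑ v : V, ∑ s : IncEdge G v → ZMod 2,
        (X (.inr (.vertex v s)) * rename .inl (∏ e, factor v s e) +
          ∑ e : IncEdge G v, X (.inr (.bool e.1 (s e))) *
            rename .inl (∏ e' ∈ Finset.univ.erase e.1, factor v s e'))) := by
  classical
  refine (gateValue_eq hG _).trans ?_
  change ∑ h ∈ gateChildren .out, gateValue hG h = _
  rw [gateChildren, Finset.sum_insert (by simp), Finset.sum_insert (by simp),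
    Finset.sum_image (by intro a; simp), gateValue_one, gateValue_edgeProd]
  congr 2
  rw [Fintype.sum_sigma]
  refine Finset.sum_congr rfl fun v _ => ?_
  rw [Fintype.sum_prod_type]
  refine Finset.sum_congr rfl fun s _ => ?_
  rw [Fintype.sum_option, gateValue_term_none]
  exact congrArg _ (Finset.sum_congr rfl fun e _ => gateValue_term_some hG v s e)

end gatePoly

/-! ### The certificate -/

theorem sum_incEdge {M : Type*} [AddCommMonoid M] (v : V) (t : G.edgeSet → M) :
    ∑ e : IncEdge G v, t e.1 = ∑ e : G.edgeSet, if v ∈ (e : Sym2 V) then t e else 0 := by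
  rw [← Finset.sum_filter]
  exact (Finset.sum_subtype _ (by simp) t).symm

/-- Double counting: each edge has two ends, so it contributes `2 • t e = 0`. -/
theorem sum_sum_incEdge_eq_zero (t : G.edgeSet → ZMod 2) :
    ∑ v : V, ∑ e : IncEdge G v, t e.1 = 0 := by
  simp_rw [sum_incEdge]
  rw [Finset.sum_comm]
  refine Finset.sum_eq_zero fun e _ => ?_
  rw [← Finset.sum_filter, Finset.sum_const]
  have h : (Finset.univ.filter fun v => v ∈ (e : Sym2 V)) = (e : Sym2 V).toFinset := by
    ext; simp
  rw [h, Sym2.card_toFinset_of_not_isDiag _ (G.not_isDiag_of_mem_edgeSet e.2), two_nsmul]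
  exact CharTwo.add_self_eq_zero _

theorem card_incEdge (h3 : G.IsRegularOfDegree 3) (v : V) : Fintype.card (IncEdge G v) = 3 := by
  rw [← h3 v, ← G.card_incidenceFinset_eq_degree v, ← Fintype.card_coe]
  refine Fintype.card_congr ⟨fun e => ⟨e.1.1, ?_⟩, fun e => ⟨⟨e.1, ?_⟩, ?_⟩, ?_, ?_⟩
  · simpa [SimpleGraph.incidenceSet] using e.2
  · have := e.2
    simp only [SimpleGraph.mem_incidenceFinset] at this
    exact this.1
  · have := e.2
    simp only [SimpleGraph.mem_incidenceFinset] at this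
    exact this.2
  · intro e; rfl
  · intro e; rfl

theorem exists_incEdge_ne (h3 : G.IsRegularOfDegree 3) (v : V) :
    ∃ a b : IncEdge G v, a.1 ≠ b.1 := by
  obtain ⟨a, b, hab⟩ : ∃ a b : IncEdge G v, a ≠ b := by
    rw [← Fintype.one_lt_card_iff, card_incEdge h3]
    norm_num
  exact ⟨a, b, fun h => hab (Subtype.ext h)⟩

/-- For every assignment of the edges, the number of violated vertex equations is odd. -/
theorem sum_one_add_parity (h3 : G.IsRegularOfDegree 3) (u : V) (t : G.edgeSet → ZMod 2) :
    ∑ v : V, (1 + ((∑ e : IncEdge G v, t e.1) + if v = u then 1 else 0)) = 1 := by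
  -- Handshake lemma: all degrees are 3, which is 1 modulo 2, so `|V|` has the parity of the degree
  -- sum.
  have hV : ∑ v : V, (1 : ZMod 2) = 0 := by
    rw [← sum_sum_incEdge_eq_zero (G := G) fun _ => 1]
    refine Finset.sum_congr rfl fun v _ => ?_
    rw [Finset.sum_const, Finset.card_univ, card_incEdge h3]
    decide
  rw [Finset.sum_add_distrib, Finset.sum_add_distrib, hV, sum_sum_incEdge_eq_zero]
  simp

theorem prod_factor (v : V) (s : IncEdge G v → ZMod 2) :
    ∏ e, factor v s e =
      ∑ t : G.edgeSet → ZMod 2 with (fun e : IncEdge G v => t e.1) = s,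
        ∏ e, (X ⟨e, t e⟩ : MvPolynomial (CFIVar G) (ZMod 2)) := by
  classical
  -- `T e` is the set of values allowed at `e`, so the choice functions for `T` are exactly the
  -- extensions of `s`.
  let T : G.edgeSet → Finset (ZMod 2) := fun e =>
    if h : v ∈ (e : Sym2 V) then {s ⟨e, h⟩} else Finset.univ
  have hT : ∀ e, factor v s e = ∑ i ∈ T e, X ⟨e, i⟩ := by
    intro e
    unfold factor
    simp only [T]
    split_ifs with h
    · simp
    · exact (Fin.sum_univ_two fun i : Fin 2 =>
        (X ⟨e, i⟩ : MvPolynomial (CFIVar G) (ZMod 2))).symm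
  rw [Finset.prod_congr rfl fun e _ => hT e, Finset.prod_univ_sum]
  refine Finset.sum_congr ?_ fun _ _ => rfl
  ext t
  simp only [Fintype.mem_piFinset, Finset.mem_filter, Finset.mem_univ, true_and, T, funext_iff]
  constructor
  · rintro h ⟨e, he⟩
    simpa [he] using h e
  · intro h e
    split_ifs with he
    · simpa using h ⟨e, he⟩
    · simp

/-- Exchanging the sums over vertices and over global assignments `t` reduces the claim to the
parity count for each single `t`. -/
theorem sum_parity_mul_prod_factor (h3 : G.IsRegularOfDegree 3) (u : V) :
    ∑ v : V, ∑ s : IncEdge G v → ZMod 2,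
      C (1 + ((∑ e, s e) + if v = u then 1 else 0)) * ∏ e, factor v s e =
      ∏ e : G.edgeSet, (X ⟨e, 0⟩ + X ⟨e, 1⟩ : MvPolynomial (CFIVar G) (ZMod 2)) := by
  classical
  have hv : ∀ v : V, ∑ s : IncEdge G v → ZMod 2,
      C (1 + ((∑ e, s e) + if v = u then 1 else 0)) * ∏ e, factor v s e =
      ∑ t : G.edgeSet → ZMod 2, C (1 + ((∑ e : IncEdge G v, t e.1) + if v = u then 1 else 0)) *
        ∏ e, (X ⟨e, t e⟩ : MvPolynomial (CFIVar G) (ZMod 2)) := by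
    intro v
    rw [← Finset.sum_fiberwise Finset.univ
      (fun (t : G.edgeSet → ZMod 2) (e : IncEdge G v) => t e.1)]
    refine Finset.sum_congr rfl fun s _ => ?_
    rw [prod_factor, Finset.mul_sum]
    refine Finset.sum_congr rfl fun t ht => ?_
    rw [← (Finset.mem_filter.mp ht).2]
  rw [Finset.sum_congr rfl fun v _ => hv v, Finset.sum_comm]
  have ht : ∀ t : G.edgeSet → ZMod 2,
      ∑ v : V, C (1 + ((∑ e : IncEdge G v, t e.1) + if v = u then 1 else 0)) *
        ∏ e, (X ⟨e, t e⟩ : MvPolynomial (CFIVar G) (ZMod 2)) = ∏ e, X ⟨e, t e⟩ := by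
    intro t
    rw [← Finset.sum_mul, ← map_sum, sum_one_add_parity h3, C_1, one_mul]
  rw [Finset.sum_congr rfl fun t _ => ht t]
  have hp : ∀ e : G.edgeSet, (X ⟨e, 0⟩ + X ⟨e, 1⟩ : MvPolynomial (CFIVar G) (ZMod 2)) =
      ∑ i : ZMod 2, X ⟨e, i⟩ := fun e =>
    (Fin.sum_univ_two fun i : Fin 2 => (X ⟨e, i⟩ : MvPolynomial (CFIVar G) (ZMod 2))).symm
  rw [Finset.prod_congr rfl fun e _ => hp e, Finset.prod_univ_sum]
  simp

/-- Since `M(v,s)` contains `x^e_{s e}`, each Boolean axiom term equals `(x^e_{s e} - 1) M(v,s)`.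
Adding the three of them to the vertex equation doubles its linear part, which vanishes, and leaves
a constant. -/
theorem cfiSystem_term (h3 : G.IsRegularOfDegree 3) (u v : V) (s : IncEdge G v → ZMod 2) :
    cfiSystem G u 1 (.vertex v s) * ∏ e, factor v s e +
      ∑ e : IncEdge G v, cfiSystem G u 1 (.bool e.1 (s e)) *
        ∏ e' ∈ Finset.univ.erase e.1, factor v s e' =
      C (1 + ((∑ e, s e) + if v = u then 1 else 0)) * ∏ e, factor v s e := by
  have hb : ∀ e : IncEdge G v, cfiSystem G u 1 (.bool e.1 (s e)) *
      ∏ e' ∈ Finset.univ.erase e.1, factor v s e' =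
      (X ⟨e.1, s e⟩ - 1) * ∏ e, factor v s e := by
    intro e
    have hf : factor v s e.1 = X ⟨e.1, s e⟩ := by simp [factor, e.2]
    rw [← Finset.mul_prod_erase Finset.univ (factor v s) (Finset.mem_univ e.1), hf, cfiSystem]
    ring
  rw [Finset.sum_congr rfl fun e _ => hb e, ← Finset.sum_mul, ← add_mul, cfiSystem,
    Finset.sum_sub_distrib]
  congr 1
  have h2 : (2 : MvPolynomial (CFIVar G) (ZMod 2)) = 0 := CharTwo.two_eq_zero
  simp only [Finset.sum_const, Finset.card_univ, card_incEdge h3, map_add, C_1, nsmul_eq_mul]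
  push_cast
  generalize ∑ e : IncEdge G v, (X ⟨e.1, s e⟩ : MvPolynomial (CFIVar G) (ZMod 2)) = a
  generalize (C (∑ e, s e) : MvPolynomial (CFIVar G) (ZMod 2)) = b
  generalize (C (if v = u then 1 else 0) : MvPolynomial (CFIVar G) (ZMod 2)) = c
  linear_combination (a - b - c - 2) * h2

theorem isIPSCertificate_circuit (h3 : G.IsRegularOfDegree 3) (u : V)
    (hG : ∀ e : G.edgeSet, ∃ v, v ∉ (e : Sym2 V)) :
    IsIPSCertificate (cfiSystem G u 1) (circuit G hG).poly := by
  have hr : ∀ (f : CFIEq G → MvPolynomial (CFIVar G) (ZMod 2))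
      (p : MvPolynomial (CFIVar G) (ZMod 2)),
      aeval (Sum.elim X f) (rename Sum.inl p) = p := by
    intro f p
    rw [aeval_rename, Sum.elim_comp_inl, aeval_X_left_apply]
  have hp : ∀ (f : CFIEq G → MvPolynomial (CFIVar G) (ZMod 2)),
      aeval (Sum.elim X f) (∏ e : G.edgeSet,
        (1 + X (.inr (.edge e)) : MvPolynomial (CFIVar G ⊕ CFIEq G) (ZMod 2))) =
      ∏ e : G.edgeSet, (1 + f (.edge e)) := by
    intro f
    rw [map_prod]
    refine Finset.prod_congr rfl fun e _ => ?_
    rw [map_add, map_one, aeval_X, Sum.elim_inr]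
  rw [poly_circuit]
  constructor
  · simp only [map_add, map_one, map_sum, map_mul, aeval_X, Sum.elim_inr, hr, hp, zero_mul,
      add_zero, Finset.sum_const_zero, Finset.prod_const_one, CharTwo.add_self_eq_zero]
  · simp only [map_add, map_one, map_sum, map_mul, aeval_X, Sum.elim_inr, hr, hp]
    simp only [cfiSystem_term h3]
    rw [sum_parity_mul_prod_factor h3]
    have he : ∀ e : G.edgeSet, (1 : MvPolynomial (CFIVar G) (ZMod 2)) + cfiSystem G u 1 (.edge e) =
        X ⟨e, 0⟩ + X ⟨e, 1⟩ := by
      intro e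
      rw [cfiSystem]
      ring
    simp only [he, CharTwo.add_self_eq_zero, add_zero]

/-- Restricted to `x = 0` and to the edge variables of `y`, a `y`-linear polynomial is additive,
while `1 + ∏ (1 + y_e)` is not. -/
theorem not_isYLinear_circuit (h3 : G.IsRegularOfDegree 3) (u : V)
    (hG : ∀ e : G.edgeSet, ∃ v, v ∉ (e : Sym2 V)) : ¬ IsYLinear (circuit G hG).poly := by
  classical
  rintro ⟨g, hg⟩
  obtain ⟨a, b, hab⟩ := exists_incEdge_ne h3 u
  let φ (y : G.edgeSet → ZMod 2) : CFIVar G ⊕ CFIEq G → ZMod 2 :=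
    Sum.elim 0 fun i => match i with | .edge e => y e | _ => 0
  have hleft (y) : aeval (φ y) (circuit G hG).poly = 1 + ∏ e, (1 + y e) := by
    have hf : ∀ (v : V) (s : IncEdge G v → ZMod 2) (e),
        aeval (fun _ : CFIVar G => (0 : ZMod 2)) (factor v s e) = 0 := by
      intro v s e
      unfold factor
      split_ifs <;> simp
    rw [poly_circuit]
    simp [φ]
  have hright (y y') : aeval (φ (y + y')) (circuit G hG).poly =
      aeval (φ y) (circuit G hG).poly + aeval (φ y') (circuit G hG).poly := by
    rw [hg]
    simp only [map_sum, map_mul, aeval_X, aeval_rename, φ, Sum.elim_comp_inl, Sum.elim_inr,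
      ← Finset.sum_add_distrib, ← add_mul]
    refine Finset.sum_congr rfl fun i _ => ?_
    cases i <;> simp
  -- At the indicators of two distinct edges and at their sum the value is always 1, so additivity
  -- would give `1 = 1 + 1`.
  have h := hright (Pi.single a.1 1) (Pi.single b.1 1)
  have hz : ∀ y : G.edgeSet → ZMod 2, ∀ e, y e = 1 → ∏ e, (1 + y e) = 0 := fun y e he =>
    Finset.prod_eq_zero (Finset.mem_univ e) (by rw [he]; exact CharTwo.add_self_eq_zero _)
  rw [hleft, hleft, hleft, hz _ a.1 (by simp [hab]), hz _ a.1 (by simp),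
    hz _ b.1 (by simp)] at h
  exact absurd h (by decide)

/-! ### Symmetry -/

/-- The action of the edge flips on the gates. -/
def flipGate (π : edgeFlipGroup G) : Gate G → Gate G
  | .one => .one
  | .var (.inl x) => .var (.inl (π +ᵥ x))
  | .var (.inr y) => .var (.inr (π +ᵥ y))
  | .edgeFactor e => .edgeFactor e
  | .edgeProd => .edgeProd
  | .pair e => .pair e
  | .term ⟨v, s, o⟩ => .term ⟨v, fun e => s e + (π : G.edgeSet → ZMod 2) e.1, o⟩
  | .out => .out

theorem add_self_edgeFlipGroup (π : edgeFlipGroup G) : π + π = 0 :=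
  Subtype.ext (funext fun _ => CharTwo.add_self_eq_zero _)

theorem flipGate_involutive (π : edgeFlipGroup G) : Function.Involutive (flipGate π) := by
  rintro (_ | (x | y) | _ | _ | _ | ⟨v, s, o⟩ | _) <;>
    simp [flipGate, vadd_vadd, add_self_edgeFlipGroup, add_assoc, CharTwo.add_self_eq_zero]

theorem flipGate_factorGate (π : edgeFlipGroup G) (v : V) (s : IncEdge G v → ZMod 2)
    (e : G.edgeSet) :
    flipGate π (factorGate v s e) =
      factorGate v (fun e => s e + (π : G.edgeSet → ZMod 2) e.1) e := by
  unfold factorGate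
  split_ifs <;> rfl

-- Equality of child sets makes the flip an automorphism. At `.pair e` the flip may swap the two
-- children, which leaves the set unchanged; at `.out` it permutes the terms.
open Classical in
theorem gateChildren_flipGate (π : edgeFlipGroup G) (g : Gate G) :
    gateChildren (flipGate π g) = (gateChildren g).image (flipGate π) := by
  rcases g with _ | (x | y) | e | _ | e | ⟨v, s, _ | e⟩ | _
  · rfl
  · rfl
  · rfl
  · simp only [flipGate, gateChildren, Finset.image_insert, Finset.image_singleton]
    rfl
  · simp only [flipGate, gateChildren, Finset.image_insert, Finset.image_image]
    rfl
  · simp only [flipGate, gateChildren, Finset.image_insert, Finset.image_singleton]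
    have key : ∀ i : ZMod 2, ({.var (.inl ⟨e, 0⟩), .var (.inl ⟨e, 1⟩)} : Finset (Gate G)) =
        {.var (.inl ⟨e, 0 + i⟩), .var (.inl ⟨e, 1 + i⟩)} := by
      intro i
      obtain rfl | rfl := eq_zero_or_eq_one i
      · simp
      · exact Finset.pair_comm _ _
    exact key _
  · simp only [flipGate, gateChildren, Finset.image_insert, Finset.image_image]
    congr 1
    exact Finset.image_congr fun e _ => (flipGate_factorGate π v s e).symm
  · simp only [flipGate, gateChildren, Finset.image_insert, Finset.image_image]
    congr 1
    exact Finset.image_congr fun e _ => (flipGate_factorGate π v s e).symm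
  · simp only [flipGate, gateChildren, Finset.image_insert, Finset.image_image]
    congr 2
    ext g
    simp only [Finset.mem_image, Finset.mem_univ, true_and, Function.comp]
    constructor
    · rintro ⟨t, rfl⟩
      obtain ⟨v, s, o⟩ := t
      refine ⟨⟨v, fun e => s e + (π : G.edgeSet → ZMod 2) e.1, o⟩, ?_⟩
      exact flipGate_involutive π (.term ⟨v, s, o⟩)
    · rintro ⟨⟨v, s, o⟩, rfl⟩
      exact ⟨_, rfl⟩

theorem mem_gateChildren_flipGate (π : edgeFlipGroup G) (g h : Gate G) :
    flipGate π h ∈ gateChildren (flipGate π g) ↔ h ∈ gateChildren g := by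
  classical
  rw [gateChildren_flipGate, (flipGate_involutive π).injective.mem_finset_image]

theorem isSymmetric_circuit (hG : ∀ e : G.edgeSet, ∃ v, v ∉ (e : Sym2 V)) :
    (circuit G hG).IsSymmetric (Multiplicative (edgeFlipGroup G)) := by
  classical
  intro γ
  refine ⟨(flipGate_involutive γ.toAdd).toPerm, fun g h => ?_, fun g => ?_⟩
  · exact mem_gateChildren_flipGate γ.toAdd g h
  · change gateLabel (flipGate _ g) = (gateLabel g).map _
    rcases g with _ | (x | y) | e | _ | e | ⟨v, s, o⟩ | _ <;> rfl

/-! ### The system is invariant -/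

/-- The variables which occur linearly in an equation of the system. -/
def linearVars : CFIEq G → Set (CFIVar G)
  | .vertex v s => Set.range fun e : IncEdge G v => ⟨e.1, s e⟩
  | .edge e => {z | z.edge = e}
  | .bool e i => {⟨e, i⟩}

/-- This reads `linearVars` off the polynomial itself, so that equal polynomials have equal sets of
linear variables. -/
theorem mem_linearVars_iff (u : V) (a : ZMod 2) (i : CFIEq G) (z : CFIVar G) :
    z ∈ linearVars i ↔ coeff (Finsupp.single z 1) (cfiSystem G u a i) ≠ 0 := by
  classical
  have hX : ∀ z' : CFIVar G,
      coeff (Finsupp.single z 1) (X z' : MvPolynomial (CFIVar G) (ZMod 2)) =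
        if z' = z then 1 else 0 := by
    intro z'
    simp only [coeff_X, Finsupp.single_left_inj one_ne_zero]
  have hC : ∀ c : ZMod 2,
      coeff (Finsupp.single z 1) (C c : MvPolynomial (CFIVar G) (ZMod 2)) = 0 := by
    intro c
    rw [coeff_C, if_neg (by simp [eq_comm])]
  rcases i with ⟨v, s⟩ | e | ⟨e, i⟩
  · rw [cfiSystem, coeff_sub, coeff_sum, hC, sub_zero, Finset.sum_congr rfl fun e _ => hX _]
    simp only [linearVars, Set.mem_range]
    constructor
    · rintro ⟨e, rfl⟩
      rw [Finset.sum_eq_single e]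
      · simp
      · intro b _ hb
        rw [if_neg]
        intro h
        exact hb (Subtype.ext (congrArg CFIVar.edge h))
      · simp
    · intro h
      obtain ⟨e, -, he⟩ := Finset.exists_ne_zero_of_sum_ne_zero h
      exact ⟨e, by simpa using he⟩
  · rw [cfiSystem, ← C_1, coeff_sub, coeff_add, hC, sub_zero, hX, hX]
    obtain ⟨e', i⟩ := z
    simp only [linearVars, Set.mem_ofPred_eq, CFIVar.mk.injEq]
    obtain rfl | rfl := eq_zero_or_eq_one i
    all_goals simp [eq_comm]
  · rw [cfiSystem, coeff_sub, hX, coeff_X_pow, if_neg]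
    · simp [linearVars, eq_comm]
    · intro h
      rw [Finsupp.single_eq_single_iff] at h
      simp at h

/-- The three kinds of equation differ in their linear variables: several edges, both values at one
edge, or a single variable. Within a kind, the variables determine the index. -/
theorem linearVars_injective (h3 : G.IsRegularOfDegree 3) :
    Function.Injective (linearVars : CFIEq G → Set (CFIVar G)) := by
  have hne : ∀ (v : V) (s : IncEdge G v → ZMod 2) (i : CFIEq G) (e : G.edgeSet),
      (∀ z ∈ linearVars i, z.edge = e) → linearVars (.vertex v s) ≠ linearVars i := by
    intro v s i e hi h
    obtain ⟨a, b, hab⟩ := exists_incEdge_ne h3 v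
    have ha := hi _ (h.subset ⟨a, rfl⟩)
    have hb := hi _ (h.subset ⟨b, rfl⟩)
    exact hab (ha.trans hb.symm)
  have hne' : ∀ (e e' : G.edgeSet) (i : ZMod 2),
      linearVars (.edge e) ≠ linearVars (.bool e' i) := by
    intro e e' i h
    have h0 : (⟨e, 0⟩ : CFIVar G) ∈ linearVars (.bool e' i) := h ▸ rfl
    have h1 : (⟨e, 1⟩ : CFIVar G) ∈ linearVars (.bool e' i) := h ▸ rfl
    have := congrArg CFIVar.val ((show _ = _ from h0).trans (show _ = _ from h1).symm)
    exact zero_ne_one (α := ZMod 2) this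
  rintro (⟨v, s⟩ | e | ⟨e, i⟩) (⟨v', s'⟩ | e' | ⟨e', i'⟩) h
  · have hs : ∀ e : IncEdge G v, ∃ e' : IncEdge G v', (⟨e'.1, s' e'⟩ : CFIVar G) = ⟨e.1, s e⟩ := by
      intro e
      have : (⟨e.1, s e⟩ : CFIVar G) ∈ linearVars (.vertex v' s') := h ▸ ⟨e, rfl⟩
      exact this
    have hv : v = v' := by
      -- Two distinct vertices share at most one edge of a simple graph, but here all edges at `v`
      -- would also contain `v'`.
      by_contra hv
      obtain ⟨a, b, hab⟩ := exists_incEdge_ne h3 v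
      have key : ∀ e : IncEdge G v, (e.1 : Sym2 V) = s(v, v') := by
        intro e
        obtain ⟨e', he'⟩ := hs e
        have he : e'.1 = e.1 := congrArg CFIVar.edge he'
        exact (Sym2.mem_and_mem_iff hv).mp ⟨e.2, he ▸ e'.2⟩
      exact hab (Subtype.ext ((key a).trans (key b).symm))
    subst hv
    congr 1
    funext e
    obtain ⟨e', he'⟩ := hs e
    have he : e' = e := Subtype.ext (congrArg CFIVar.edge he')
    subst he
    exact (congrArg CFIVar.val he').symm
  · exact absurd h (hne v s _ e' fun z hz => hz)
  · exact absurd h (hne v s _ e' fun z hz => congrArg CFIVar.edge hz)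
  · exact absurd h.symm (hne v' s' _ e fun z hz => hz)
  · have h0 : (⟨e, 0⟩ : CFIVar G) ∈ linearVars (.edge e') := h ▸ rfl
    exact congrArg CFIEq.edge h0
  · exact absurd h (hne' e e' i')
  · exact absurd h.symm (hne v' s' _ e fun z hz => congrArg CFIVar.edge hz)
  · exact absurd h.symm (hne' e' e i)
  · have h0 := Set.singleton_injective h
    rw [CFIVar.mk.injEq] at h0
    rw [h0.1, h0.2]

/-- The constant of a vertex equation is unchanged because a flip sums to zero around each vertex;
an edge equation is symmetric in its two variables. -/
theorem rename_cfiSystem (u : V) (a : ZMod 2) (π : edgeFlipGroup G) (i : CFIEq G) :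
    rename (fun x => π +ᵥ x) (cfiSystem G u a i) = cfiSystem G u a (π +ᵥ i) := by
  rcases i with ⟨v, s⟩ | e | ⟨e, i⟩
  · have hs : ∑ e : IncEdge G v, (s e + (π : G.edgeSet → ZMod 2) e.1) = ∑ e, s e := by
      rw [Finset.sum_add_distrib, π.2 v, add_zero]
    change _ = cfiSystem G u a (.vertex v fun e => s e + (π : G.edgeSet → ZMod 2) e.1)
    rw [cfiSystem, cfiSystem, hs, map_sub, map_sum, rename_C]
    simp only [rename_X]
    rfl
  · change _ = cfiSystem G u a (.edge e)
    rw [cfiSystem, map_sub, map_add, rename_X, rename_X, map_one]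
    have key : ∀ j : ZMod 2, (X ⟨e, 0 + j⟩ + X ⟨e, 1 + j⟩ : MvPolynomial (CFIVar G) (ZMod 2)) =
        X ⟨e, 0⟩ + X ⟨e, 1⟩ := by
      intro j
      obtain rfl | rfl := eq_zero_or_eq_one j
      · simp
      · exact add_comm _ _
    exact congrArg (· - 1) (key ((π : G.edgeSet → ZMod 2) e))
  · change _ = cfiSystem G u a (.bool e (i + (π : G.edgeSet → ZMod 2) e))
    rw [cfiSystem, cfiSystem, map_sub, map_pow, rename_X]
    rfl

theorem isInvariantSystem_cfiSystem (h3 : G.IsRegularOfDegree 3) (u : V) (a : ZMod 2) :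
    IsInvariantSystem (Multiplicative (edgeFlipGroup G)) (cfiSystem G u a) where
  injective i j h := linearVars_injective h3 <| Set.ext fun z => by
    rw [mem_linearVars_iff u a, mem_linearVars_iff u a, h]
  rename_eq γ i := rename_cfiSystem u a γ.toAdd i

/-! ### The size -/

/-- A vertex of degree 3 forces at least four vertices, and an edge has only two. -/
theorem exists_notMem_edge (h3 : G.IsRegularOfDegree 3) (e : G.edgeSet) :
    ∃ v, v ∉ (e : Sym2 V) := by
  by_contra! h
  obtain ⟨v, hv⟩ : ∃ v, v ∈ (e : Sym2 V) := ⟨_, Sym2.out_fst_mem _⟩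
  have hlt := G.degree_lt_card_verts v
  have hle : Fintype.card V ≤ (e : Sym2 V).toFinset.card := by
    rw [← Finset.card_univ]
    exact Finset.card_le_card fun w _ => Sym2.mem_toFinset.mpr (h w)
  rw [Sym2.card_toFinset_of_not_isDiag _ (G.not_isDiag_of_mem_edgeSet e.2)] at hle
  have := h3 v
  omega

theorem card_gate_le (h3 : G.IsRegularOfDegree 3) :
    Fintype.card (Gate G) ≤ 7 * (Fintype.card (CFIVar G) + Fintype.card (CFIEq G)) + 3 := by
  -- Each pair `(v, s)` carries four terms: one for the vertex equation and one for each of the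
  -- three edges at `v`.
  have hT : Fintype.card (TermIndex G) = 4 * Fintype.card (Σ v : V, IncEdge G v → ZMod 2) := by
    rw [Fintype.card_sigma, Fintype.card_sigma, Finset.mul_sum]
    refine Finset.sum_congr rfl fun v _ => ?_
    rw [Fintype.card_prod, Fintype.card_option, card_incEdge h3, mul_comm]
  rw [Fintype.card_congr (Gate.equivSum G)]
  simp only [Fintype.card_sum, Fintype.card_fin, hT]
  have hY := Fintype.card_congr (CFIEq.equivSum G)
  simp only [Fintype.card_sum] at hY
  omega

end CFI

theorem theorem6p2 :
    ∃ p : Polynomial ℕ,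
      ∀ (V : Type) [Fintype V] [DecidableEq V] (G : SimpleGraph V) [DecidableRel G.Adj],
        G.IsRegularOfDegree 3 → ∀ u : V,
          ∃ C : AlgCircuit (CFIVar G ⊕ CFIEq G) (ZMod 2),
            IsSymIPSRefutation (Multiplicative (edgeFlipGroup G)) (cfiSystem G u 1) C ∧
            ¬ IsYLinear C.poly ∧
            ipsSize C ≤ p.eval (systemSize (cfiSystem G u 1)) := by
  -- The 7 counts one gate per variable, two per edge and four per vertex equation, each bounded by
  -- the system size; the 3 counts `.one`, `.edgeProd` and `.out`.
  refine ⟨7 * Polynomial.X + 3, fun V _ _ G _ h3 u => ?_⟩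
  have hG := CFI.exists_notMem_edge h3
  refine ⟨CFI.circuit G hG, ⟨CFI.isInvariantSystem_cfiSystem h3 u 1,
    CFI.isIPSCertificate_circuit h3 u hG, CFI.isSymmetric_circuit hG⟩,
    CFI.not_isYLinear_circuit h3 u hG, ?_⟩
  have hcard := CFI.card_gate_le h3
  simp only [Polynomial.eval_add, Polynomial.eval_mul, Polynomial.eval_X, Polynomial.eval_ofNat,
    systemSize, ipsSize]
  exact max_le hcard (by omega)
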